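/- Let $K\ge 0$, let $X=\{1,\dots,K\}$ be the set of possible initial values, and let $Y$ be a finite subset of an abelian group $R$ (for instance of $\mathbb R$) with a distinguished element $\emptyset\in Y$. **Model of computation.** A network is a finite connected simple undirected graph $G$ with node set $\{1,\dots,n\}$ together with a port labelling: each node $i$, of degree $d(i)$, numbers its neighbors bijectively by ports $1,\dots,d(i)$. A family of automata consists of a finite message set $M$, finite memory sets $Z_d$ such that $\log|Z_d|\le Cd$ for some constant $C$ and all $d$, null elements $\emptyset\in M$, $\emptyset\in Z_d$, and transition laws $A_d: X\times Z_d\times Y\times M^d\to Z_d\times Y\times M^d$ for each degree $d$. All nodes of degree $d$ run $A_d$: node $i$ has initial value $x_i\in X$, starts at time $0$ with memory, output and all messages equal to $\emptyset$, and at each time step applies $A_{d(i)}$ to $x_i$, to its current memory and output, and to the $d(i)$ messages it receives, the $k$-th of them being the one that its neighbor $j$ across port $k$ currently has in the port of $j$ leading to $i$; the result is its new memory, output and outgoing messages. The final output is $y^*\in Y$ if from some time on the output of every node is $y^*$. A family of functions $f_n:X^n\to Y$ is computable if there is one family of automata whose final output is $f_n(x_1,\dots,x_n)$ for every $n\ge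 1$, every connected graph on $n$ nodes, every port labelling and all initial values $x\in X^n$. **Functions of the proportions.** Let $D=\{p\in[0,1]^K:\sum_{k=1}^K p_k=1\}$. A function $h:D\to Y$ is computable if there is a computable family $(f_n)$ with $f_n(x)=h(p_1(x),\dots,p_K(x))$ for all $n\ge1$ and $x\in X^n$, where $p_k(x)=|\{i:x_i=k\}|/n$. A rational open box is a set $\prod_{k=1}^K(a_k,b_k)\subset\mathbb R^K$ with all $a_k,b_k$ rational. A function $D\to Y$ is a box function if it is the restriction to $D$ of a finite sum $\sum_i c_i 1_{B_i}$, where the $B_i$ are rational open boxes and $c_i\in R$. Let $\mu$ be the $(K-1)$-dimensional Lebesgue measure on $D$. **Corollary.** Let $h:D\to Y$ be a function all of whose level sets $\{p\in D: h(p)=y\}$, $y\in Y$, are Lebesgue measurable (with respect to $\mu$). Then for every $\varepsilon>0$ there is a computable box function $h_\varepsilon:D\to Y$ such that $\mu(\{p\in D: h(p)\neq h_\varepsilon(p)\})\le\varepsilon$. -/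

import Mathlib

open MeasureTheory

noncomputable section

namespace AnonNet

/-- A family of automata `(A_d)`, one for each node degree `d`, for nodes with initial values in
`X` and outputs in `Y`. All nodes of degree `d` run the same automaton, which knows neither the
size nor the topology of the network. The automaton `A_0` only serves the one-node network. -/
structure AutomatonFamily (X Y : Type*) where
  /-- the message alphabet, common to all degrees -/
  Msg : Type
  /-- the internal memory of a node of degree `d` -/
  Mem : ℕ → Type
  finite_msg : Finite Msg
  finite_mem : ∀ d, Finite (Mem d)
  /-- the null message `∅` -/
  msg₀ : Msg
  /-- the null memory state `∅` -/
  mem₀ : ∀ d, Mem d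
  /-- The transition law: initial value, memory, output and the messages received through the ports
  are mapped to the new memory, the new output and the messages sent into the ports.
  The initial value never changes. -/
  next : ∀ d, X → Mem d → Y → (Fin d → Msg) → Mem d × Y × (Fin d → Msg)
  /-- The number of bits stored at a node is at most proportional to its degree. -/
  memory_bound : ∃ C : ℝ, ∀ d : ℕ, Real.log (Nat.card (Mem d)) ≤ C * d

/-- A port labelling: at each node `i`, the edges leaving `i` are numbered by `Fin (degree i)`. -/
abbrev PortLabeling {n : ℕ} (G : SimpleGraph (Fin n)) [DecidableRel G.Adj] : Type :=
  ∀ i : Fin n, Fin (G.degree i) ≃ G.neighborSet i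

namespace PortLabeling

variable {n : ℕ} {G : SimpleGraph (Fin n)} [DecidableRel G.Adj]

/-- The neighbor `j` of `i` to which port `k` of node `i` leads. -/
def nbr (P : PortLabeling G) (i : Fin n) (k : Fin (G.degree i)) : Fin n :=
  (P i k : Fin n)

theorem adj_nbr (P : PortLabeling G) (i : Fin n) (k : Fin (G.degree i)) :
    G.Adj (nbr P i k) i :=
  SimpleGraph.Adj.symm (P i k).2

/-- The port number, at the neighbor `j = nbr P i k` of `i`, of the link from `j` to `i`. -/
def backPort (P : PortLabeling G) (i : Fin n) (k : Fin (G.degree i)) :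
    Fin (G.degree (nbr P i k)) :=
  (P (nbr P i k)).symm ⟨i, adj_nbr P i k⟩

end PortLabeling

/-- The variable part of the state of a node of degree `d`. -/
structure NodeState {X Y : Type*} (A : AutomatonFamily X Y) (d : ℕ) where
  mem : A.Mem d
  out : Y
  msg : Fin d → A.Msg

/-- The state of node `i` at time `t`, on the network `G` with port labelling `P` and initial values
`x`. At time `0` memory, output and messages are null, where `y₀` is the null output. At each
round node `i` receives through its port `k` the message that its neighbor across
that port last sent into the port leading back to `i`. -/
def run {X Y : Type*} (A : AutomatonFamily X Y) (y₀ : Y) {n : ℕ} (G : SimpleGraph (Fin n))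
    [DecidableRel G.Adj] (P : PortLabeling G) (x : Fin n → X) :
    ℕ → ∀ i : Fin n, NodeState A (G.degree i)
  | 0 => fun _ => ⟨A.mem₀ _, y₀, fun _ => A.msg₀⟩
  | t + 1 => fun i =>
      let S := run A y₀ G P x t
      let r := A.next (G.degree i) (x i) (S i).mem (S i).out
        (fun k => (S (PortLabeling.nbr P i k)).msg (PortLabeling.backPort P i k))
      ⟨r.1, r.2.1, r.2.2⟩

/-- `y` is the final output: from some time on, all nodes hold the output `y`. -/
def IsFinalOutput {X Y : Type*} (A : AutomatonFamily X Y) (y₀ : Y) {n : ℕ}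
    (G : SimpleGraph (Fin n)) [DecidableRel G.Adj] (P : PortLabeling G) (x : Fin n → X)
    (y : Y) : Prop :=
  ∃ t₀ : ℕ, ∀ t, t₀ ≤ t → ∀ i, (run A y₀ G P x t i).out = y

/-- The family `f n : X ^ n → Y` is computable: one family of automata produces the final
output `f n x` on every connected network with `n` nodes, for every `n`, every port labelling
and all initial values `x`. (Connected graphs are non-empty, so `f 0` plays no role.) -/
def FamilyComputable {X Y : Type*} (y₀ : Y) (f : ∀ n : ℕ, (Fin n → X) → Y) : Prop :=
  ∃ A : AutomatonFamily X Y, ∀ (n : ℕ) (G : SimpleGraph (Fin n)) [DecidableRel G.Adj],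
    G.Connected → ∀ (P : PortLabeling G) (x : Fin n → X), IsFinalOutput A y₀ G P x (f n x)

/-- The proportion set `{p ∈ [0,1]^K : ∑ p_k = 1}`. -/
def proportionSet (K : ℕ) : Set (EuclideanSpace ℝ (Fin K)) :=
  {p | (∀ k, p k ∈ Set.Icc (0 : ℝ) 1) ∧ ∑ k, p k = 1}

/-- The frequency vector of `x`: its `k`-th entry is `|{i : x i = k}| / n`. -/
def freq {K n : ℕ} (x : Fin n → Fin K) : EuclideanSpace ℝ (Fin K) :=
  WithLp.toLp 2 fun k => ((Finset.univ.filter fun i => x i = k).card : ℝ) / n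

theorem freq_mem {K n : ℕ} (hn : n ≠ 0) (x : Fin n → Fin K) : freq x ∈ proportionSet K := by
  have hn' : (0 : ℝ) < n := by exact_mod_cast Nat.pos_of_ne_zero hn
  refine ⟨fun k => ⟨?_, ?_⟩, ?_⟩
  · simp only [freq]; positivity
  · simp only [freq]
    rw [div_le_one hn']
    exact_mod_cast (Finset.card_le_univ _).trans (by simp)
  · simp only [freq]
    rw [← Finset.sum_div, div_eq_one_iff_eq hn'.ne']
    have h := Finset.card_eq_sum_card_fiberwise (s := Finset.univ) (t := Finset.univ) (f := x)
      (fun _ _ => by simp)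
    rw [Finset.card_univ, Fintype.card_fin] at h
    exact_mod_cast h.symm

/-- `h` corresponds to the family `f`: `f n x` is the value of `h` at the frequencies of `x`. -/
def Corresponds {K : ℕ} {Y : Type*} (h : proportionSet K → Y)
    (f : ∀ n : ℕ, (Fin n → Fin K) → Y) : Prop :=
  ∀ (n : ℕ) (hn : n ≠ 0) (x : Fin n → Fin K), f n x = h ⟨freq x, freq_mem hn x⟩

/-- A function on the proportion set is computable if it corresponds to a computable family. -/
def IsComputable {K : ℕ} {Y : Type*} (y₀ : Y) (h : proportionSet K → Y) : Prop :=
  ∃ f : ∀ n : ℕ, (Fin n → Fin K) → Y, Corresponds h f ∧ FamilyComputable y₀ f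

/-- The level set `L(y)`. -/
def levelSet {K : ℕ} {Y : Type*} (h : proportionSet K → Y) (y : Y) : Set (proportionSet K) :=
  {p | h p = y}

/-- Lebesgue measure on the proportion set, which is a subset of an affine space of dimension
`K - 1`: the `(K - 1)`-dimensional volume (Hausdorff measure for the Euclidean distance,
normalized to agree with Lebesgue measure on `ℝ ^ (K - 1)`). -/
def proportionVolume (K : ℕ) : Measure (proportionSet K) :=
  μHE[K - 1]

/-- The rational open box `∏ (a_k, b_k)`. -/
def rationalBox {K : ℕ} (a b : Fin K → ℚ) : Set (EuclideanSpace ℝ (Fin K)) :=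
  {p | ∀ k, p k ∈ Set.Ioo (a k : ℝ) (b k : ℝ)}

/-- A box function: a finite sum `∑ c_i 1_{B_i}` with `B_i` rational open boxes (here as a function
on the proportion set, with values in the subset `Y` of the coefficient group). -/
def IsBoxFunction {K : ℕ} {R : Type*} [AddCommGroup R] {Y : Set R} (h : proportionSet K → Y) :
    Prop :=
  ∃ (N : ℕ) (c : Fin N → R) (a b : Fin N → Fin K → ℚ),
    ∀ p : proportionSet K,
      (h p : R) = ∑ i, (rationalBox (a i) (b i)).indicator (fun _ => c i) (p : EuclideanSpace ℝ _)

end AnonNet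

end

/-! Two independent facts are combined: every box function is computable, and box functions are
dense among finite-valued measurable functions on the simplex.

Computability. A comparison of a frequency with a rational becomes, after clearing denominators, a
test whether a sum of integer weights of the nodes is positive. Positive weights are put down as
chips and negative ones as demands. The chips walk through the network, and a node absorbs chips
until its demand is met. By conservation, chips survive exactly when the sum is positive. Rotors
make the walk fair: if chips survive, connectivity brings them to every node again and again
(`RotorWalk.extinct_or_recurrent`). Silence alone would not tell a node that the chips have died
out, so a second population of messengers, initially one per node, walks as well. Each node removes
one messenger, but only once a positive chip has passed through it. If chips survive, all messengers
get removed and passing chips set every output to `true`. If chips die out, some node was never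
passed, so a messenger survives and sets every output to `false` (`chipRun_out`). Finitely many such
tests run in parallel, and the tests determine the value of a box function.

Density. Boxes are closed under intersection, so the sets with indicator an integer combination of
box indicators form an algebra. It generates the Borel sets, and the volume is finite, so it
approximates every level set (`exists_mem_boxAlgebra_symmDiff_le`). Making these approximations
disjoint gives the box function. -/

noncomputable section

namespace AnonNet

/-! ### Routing chips through ports of bounded capacity -/

/-- `h` chips can be distributed over `d` ports of capacity `B`, with a nonempty load on a
prescribed port. -/
theorem exists_route (d B h : ℕ) (c : Fin (d + 1)) :
    ∃ δ : Fin d → Fin (B + 1), h ≤ d * B →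
      ∑ p, (δ p : ℕ) = h ∧ ∀ p : Fin d, p.castSucc = c → 1 ≤ h → 1 ≤ (δ p : ℕ) := by
  have key : ∀ (s : Finset (Fin d)) (h : ℕ), h ≤ s.card * B →
      ∃ δ : Fin d → Fin (B + 1), (∀ p, p ∉ s → δ p = 0) ∧ ∑ p ∈ s, (δ p : ℕ) = h := by
    intro s
    induction s using Finset.induction_on with
    | empty => intro h hh; exact ⟨fun _ => 0, fun _ _ => rfl, by simp at hh; simp [hh]⟩
    | insert a s ha ih =>
      intro h hh
      rw [Finset.card_insert_of_notMem ha, add_mul, one_mul] at hh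
      obtain ⟨δ, h0, hs⟩ := ih (h - min h B) (by omega)
      refine ⟨Function.update δ a ⟨min h B, by omega⟩, fun p hp => ?_, ?_⟩
      · rw [Finset.mem_insert, not_or] at hp
        rw [Function.update_of_ne hp.1, h0 p hp.2]
      · rw [Finset.sum_insert ha, Finset.sum_congr rfl (g := fun p => (δ p : ℕ)), hs]
        · simp
        · intro p hp
          rw [Function.update_of_ne (by rintro rfl; exact ha hp)]
  by_cases hh : h ≤ d * B
  swap
  · exact ⟨fun _ => 0, fun h' => absurd h' hh⟩
  by_cases hc : ∃ p : Fin d, p.castSucc = c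
  · obtain ⟨q, rfl⟩ := hc
    have hd : (Finset.univ.erase q).card = d - 1 := by
      rw [Finset.card_erase_of_mem (Finset.mem_univ _), Finset.card_univ, Fintype.card_fin]
    have hd1 : d = (d - 1) + 1 := by have := q.2; omega
    have hB : h ≤ (d - 1) * B + B := by
      rw [hd1, add_mul, one_mul] at hh; exact hh
    -- Port `q` is filled first; what remains fits into the other `d - 1` ports.
    obtain ⟨δ, -, hs⟩ := key (Finset.univ.erase q) (h - min h B) (by rw [hd]; omega)
    refine ⟨Function.update δ q ⟨min h B, by omega⟩, fun _ => ⟨?_, ?_⟩⟩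
    · rw [← Finset.add_sum_erase _ _ (Finset.mem_univ q),
        Finset.sum_congr rfl (g := fun p => (δ p : ℕ)), hs]
      · simp
      · intro p hp
        rw [Function.update_of_ne (Finset.ne_of_mem_erase hp)]
    · intro p hp h1
      obtain rfl := Fin.castSucc_injective _ hp
      have : B ≠ 0 := by rintro rfl; omega
      simp; omega
  · obtain ⟨δ, -, hs⟩ := key Finset.univ h (by simpa using hh)
    exact ⟨δ, fun _ => ⟨hs, fun p hp => absurd ⟨p, hp⟩ hc⟩⟩

/-- The distribution of `h` chips over `d` ports of capacity `B` that serves port `c`. -/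
def route (d B h : ℕ) (c : Fin (d + 1)) : Fin d → Fin (B + 1) :=
  (exists_route d B h c).choose

theorem sum_route {d B h : ℕ} (c : Fin (d + 1)) (hh : h ≤ d * B) :
    ∑ p, (route d B h c p : ℕ) = h :=
  ((exists_route d B h c).choose_spec hh).1

theorem one_le_route {d B h : ℕ} (hh : h ≤ d * B) (h1 : 1 ≤ h) (p : Fin d) :
    1 ≤ (route d B h p.castSucc p : ℕ) :=
  ((exists_route d B h p.castSucc).choose_spec hh).2 p rfl h1

/-! ### Rotor walks: extinction or recurrence -/

section Walk

variable {n : ℕ} {G : SimpleGraph (Fin n)} [DecidableRel G.Adj] (P : PortLabeling G)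

/-- The total number of chips that node `i` receives when port `p` of node `j` sends `N j p`. -/
def inflow (N : ∀ i, Fin (G.degree i) → ℕ) (i : Fin n) : ℕ :=
  ∑ k, N (PortLabeling.nbr P i k) (PortLabeling.backPort P i k)

theorem PortLabeling.nbr_backPort (i : Fin n) (k : Fin (G.degree i)) :
    PortLabeling.nbr P (PortLabeling.nbr P i k) (PortLabeling.backPort P i k) = i := by
  unfold PortLabeling.backPort
  rw [PortLabeling.nbr, Equiv.apply_symm_apply]

theorem PortLabeling.nbr_injective (i : Fin n) : Function.Injective (PortLabeling.nbr P i) :=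
  fun _ _ h => (P i).injective (Subtype.ext h)

/-- The involution of the set of all ports that exchanges the two ends of each link. -/
theorem PortLabeling.flip_bijective :
    Function.Bijective (fun a : (Σ i, Fin (G.degree i)) =>
      (⟨PortLabeling.nbr P a.1 a.2, PortLabeling.backPort P a.1 a.2⟩ :
        Σ i, Fin (G.degree i))) := by
  rw [← Finite.injective_iff_bijective]
  rintro ⟨i, k⟩ ⟨j, l⟩ h
  have h2 := congrArg (fun a : (Σ i, Fin (G.degree i)) => PortLabeling.nbr P a.1 a.2) h
  simp only [PortLabeling.nbr_backPort] at h2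
  subst h2
  have h1 : PortLabeling.nbr P i k = PortLabeling.nbr P i l := congrArg Sigma.fst h
  exact congrArg (Sigma.mk i) (PortLabeling.nbr_injective P i h1)

theorem sum_inflow (N : ∀ i, Fin (G.degree i) → ℕ) :
    ∑ i, inflow P N i = ∑ i, ∑ p, N i p := by
  unfold inflow
  rw [← Fintype.sum_sigma' (f := fun i p => N i p),
    ← Fintype.sum_sigma' (f := fun i k =>
      N (PortLabeling.nbr P i k) (PortLabeling.backPort P i k))]
  exact (PortLabeling.flip_bijective P).sum_comp (fun a : (Σ i, Fin (G.degree i)) => N a.1 a.2)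

theorem le_inflow (N : ∀ i, Fin (G.degree i) → ℕ) (i : Fin n) (p : Fin (G.degree i)) :
    N i p ≤ inflow P N (PortLabeling.nbr P i p) := by
  have h : PortLabeling.nbr P i p = PortLabeling.nbr P i p := rfl
  -- The link is compared as an element of the sigma type, which avoids casts between `Fin (G.degree
  -- _)` for propositionally equal nodes.
  have key : ∀ (j : Fin n) (l : Fin (G.degree j)) ,
      (⟨PortLabeling.nbr P j l, PortLabeling.backPort P j l⟩ : Σ i, Fin (G.degree i)) = ⟨i, p⟩ →
      N i p ≤ inflow P N j := by
    intro j l hjl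
    have : N i p = N (PortLabeling.nbr P j l) (PortLabeling.backPort P j l) :=
      (congrArg (fun a : (Σ i, Fin (G.degree i)) => N a.1 a.2) hjl).symm
    rw [this]
    exact Finset.single_le_sum
      (f := fun l => N (PortLabeling.nbr P j l) (PortLabeling.backPort P j l))
      (fun _ _ => Nat.zero_le _) (Finset.mem_univ l)
  obtain ⟨⟨j, l⟩, hjl⟩ := (PortLabeling.flip_bijective P).2 ⟨i, p⟩
  have hj : PortLabeling.nbr P i p = j := by
    have := PortLabeling.nbr_backPort P j l
    rw [← this]
    exact (congrArg (fun a : (Σ i, Fin (G.degree i)) => PortLabeling.nbr P a.1 a.2) hjl).symm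
  rw [hj]
  exact key j l hjl

/-- A synchronous rotor walk of chips on a network. At time `t` port `p` of node `i` sends
`load t i p` chips; `kept t i` of the chips that reach `i` survive and are all sent on, and the
port to which the rotor of `i` points gets at least one of them. -/
structure RotorWalk where
  load : ℕ → ∀ i, Fin (G.degree i) → ℕ
  kept : ℕ → Fin n → ℕ
  rotor : ℕ → ∀ i, Fin (G.degree i + 1)
  kept_le : ∀ t i, kept t i ≤ inflow P (load t) i
  sum_load : ∀ t i, ∑ p, load (t + 1) i p = kept t i
  rotor_idle : ∀ t i, kept t i = 0 → rotor (t + 1) i = rotor t i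
  rotor_succ : ∀ t i, 1 ≤ kept t i → rotor (t + 1) i = rotor t i + 1
  served : ∀ t i (p : Fin (G.degree i)), p.castSucc = rotor t i → 1 ≤ kept t i →
    1 ≤ load (t + 1) i p

namespace RotorWalk

variable {P} (W : RotorWalk P)

/-- The number of chips that reach node `i` at time `t`. -/
abbrev arrive (t : ℕ) (i : Fin n) : ℕ := inflow P (W.load t) i

theorem sum_arrive_succ (t : ℕ) : ∑ i, W.arrive (t + 1) i = ∑ i, W.kept t i := by
  rw [sum_inflow]
  exact Finset.sum_congr rfl fun i _ => W.sum_load t i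

theorem sum_arrive_antitone : Antitone fun t => ∑ i, W.arrive t i := by
  refine antitone_nat_of_succ_le fun t => ?_
  rw [W.sum_arrive_succ]
  exact Finset.sum_le_sum fun i _ => W.kept_le t i

theorem rotor_recurrent (i : Fin n) (h : ∀ T, ∃ t ≥ T, 1 ≤ W.kept t i) (T : ℕ)
    (v : Fin (G.degree i + 1)) : ∃ t ≥ T, 1 ≤ W.kept t i ∧ W.rotor t i = v := by
  -- The rotor moves only in active rounds, so its value at `t` is still in place at the next active
  -- one.
  have next : ∀ t, ∃ t' ≥ t, 1 ≤ W.kept t' i ∧ W.rotor t' i = W.rotor t i := by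
    intro t
    by_contra! hcon
    have hrot : ∀ s, W.rotor (t + s) i = W.rotor t i := by
      intro s
      induction s with
      | zero => rfl
      | succ s ih =>
        have : W.kept (t + s) i = 0 := by
          by_contra h0
          exact hcon (t + s) (by omega) (by omega) ih
        rw [← add_assoc, W.rotor_idle _ _ this, ih]
    obtain ⟨t', ht', h1⟩ := h t
    obtain ⟨s, rfl⟩ := Nat.exists_eq_add_of_le ht'
    exact hcon _ ht' h1 (hrot s)
  -- Advancing by one per active round, the rotor runs through the whole cyclic group `Fin (G.degree
  -- i + 1)`, including the last value, which is no port.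
  have step : ∀ v, ∃ t ≥ T, 1 ≤ W.kept t i ∧ W.rotor t i = W.rotor T i + v := by
    intro v
    induction v using Fin.induction with
    | zero => simpa using next T
    | succ v ih =>
      obtain ⟨t, ht, h1, hr⟩ := ih
      obtain ⟨t', ht', h1', hr'⟩ := next (t + 1)
      refine ⟨t', by omega, h1', ?_⟩
      rw [hr', W.rotor_succ t i h1, hr, add_assoc, Fin.coeSucc_eq_succ]
  obtain ⟨t, ht, h1, hr⟩ := step (v - W.rotor T i)
  exact ⟨t, ht, h1, by rw [hr]; abel⟩

/-- Either the chips die out, or from some time on no chip disappears and every node is visited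
again and again. -/
theorem extinct_or_recurrent (hG : G.Connected) :
    (∃ T, ∀ t ≥ T, ∀ i, W.arrive t i = 0) ∨
    ∃ T, (∀ t ≥ T, ∀ i, W.kept t i = W.arrive t i) ∧
      ∀ i, ∀ s, ∃ t ≥ s, 1 ≤ W.arrive t i := by
  -- The total never increases, so it is constant from a time at which it is minimal.
  obtain ⟨T, hT⟩ : ∃ T, ∀ t ≥ T, ∑ i, W.arrive t i = ∑ i, W.arrive T i := by
    let f := fun t => ∑ i, W.arrive t i
    exact ⟨Function.argmin f, fun t ht =>
      le_antisymm (W.sum_arrive_antitone ht) (Function.argmin_le f t)⟩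
  by_cases h0 : ∑ i, W.arrive T i = 0
  · refine Or.inl ⟨T, fun t ht i => ?_⟩
    have := hT t ht
    rw [h0, Finset.sum_eq_zero_iff] at this
    exact this i (Finset.mem_univ i)
  right
  have hk : ∀ t ≥ T, ∀ i, W.kept t i = W.arrive t i := by
    intro t ht i
    have h1 : ∑ i, W.kept t i = ∑ i, W.arrive t i := by
      rw [← W.sum_arrive_succ, hT _ (by omega), hT t ht]
    exact (Finset.sum_eq_sum_iff_of_le fun i _ => W.kept_le t i).1 h1 i (Finset.mem_univ i)
  refine ⟨T, hk, ?_⟩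
  have hex : ∀ s, ∃ i, ∃ t ≥ s, 1 ≤ W.arrive t i := by
    intro s
    by_contra! hcon
    refine h0 ?_
    rw [← hT (max s T) (le_max_right _ _)]
    exact Finset.sum_eq_zero fun i _ => by
      have := hcon i (max s T) (le_max_left _ _); omega
  -- Pigeonhole: there are finitely many nodes and at every late time one of them is visited.
  obtain ⟨i₀, hi₀⟩ : ∃ i, ∀ s, ∃ t ≥ s, 1 ≤ W.arrive t i := by
    by_contra! hcon
    choose s hs using hcon
    obtain ⟨i, t, ht, h1⟩ := hex (Finset.univ.sup s)
    have := hs i t ((Finset.le_sup (Finset.mem_univ i)).trans ht)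
    omega
  -- The rotor of a recurrent node points to the port towards `j` in infinitely many active rounds,
  -- and each of them sends a chip to `j`.
  have spread : ∀ i j, G.Adj i j → (∀ s, ∃ t ≥ s, 1 ≤ W.arrive t i) →
      ∀ s, ∃ t ≥ s, 1 ≤ W.arrive t j := by
    intro i j hij hi s
    let p : Fin (G.degree i) := (P i).symm ⟨j, hij⟩
    have hp : PortLabeling.nbr P i p = j := by simp [PortLabeling.nbr, p]
    obtain ⟨t, ht, h1, hr⟩ := W.rotor_recurrent i (fun s => by
      obtain ⟨t, ht, h1⟩ := hi (max s T)
      exact ⟨t, le_of_max_le_left ht, by rw [hk t (le_of_max_le_right ht)]; exact h1⟩) s p.castSucc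
    refine ⟨t + 1, by omega, (W.served t i p hr.symm h1).trans ?_⟩
    have := le_inflow P (W.load (t + 1)) i p
    rwa [hp] at this
  intro i
  obtain ⟨w⟩ := hG.preconnected i₀ i
  induction w with
  | nil => exact hi₀
  | cons hadj _ ih => exact ih (spread _ _ hadj hi₀)

end RotorWalk

end Walk

open Filter

/-! ### The threshold protocol at one node -/

/-- A message of the threshold protocol: a number of positive chips and a number of messengers. -/
abbrev ChipMsg (B : ℕ) : Type := Fin (B + 1) × Fin (B + 1)

/-- The memory of the threshold protocol. The `demand` is the number of positive chips that the
node has yet to absorb. The `flag` is `2` until a positive chip passes through the node, `1` until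
the node then absorbs a messenger, and `0` afterwards. -/
@[ext] structure ChipState (B d : ℕ) where
  demand : Fin (B + 1)
  flag : Fin 3
  out : Bool
  plusRotor : Fin (d + 1)
  messRotor : Fin (d + 1)

namespace ChipState

variable {B d : ℕ}

/-- The components of a state as a tuple. -/
def toTuple (s : ChipState B d) : Fin (B + 1) × Fin 3 × Bool × Fin (d + 1) × Fin (d + 1) :=
  (s.demand, s.flag, s.out, s.plusRotor, s.messRotor)

theorem toTuple_injective : Function.Injective (toTuple : ChipState B d → _) := by
  intro s t h
  simp only [toTuple, Prod.mk.injEq] at h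
  exact ChipState.ext h.1 h.2.1 h.2.2.1 h.2.2.2.1 h.2.2.2.2

instance : Finite (ChipState B d) := Finite.of_injective _ toTuple_injective

/-- Each rotor costs a factor `d + 1 ≤ 2 ^ d` and the remaining fields cost a constant `6 * (B +
1)`; hence `24 = 6 * 2 * 2`. This makes the logarithm linear in `d`. -/
theorem card_le (hd : 1 ≤ d) : Nat.card (ChipState B d) ≤ (24 * (B + 1)) ^ d := by
  have h1 := Nat.card_le_card_of_injective _ (toTuple_injective (B := B) (d := d))
  have h2 : d + 1 ≤ 2 ^ d := Nat.lt_two_pow_self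
  have h3 : 6 * (B + 1) ≤ (6 * (B + 1)) ^ d := Nat.le_self_pow (by omega) _
  rw [Nat.card_eq_fintype_card (α := _ × _)] at h1
  simp only [Fintype.card_prod, Fintype.card_fin, Fintype.card_bool] at h1
  calc _ ≤ _ := h1
    _ = 6 * (B + 1) * ((d + 1) * (d + 1)) := by ring
    _ ≤ (6 * (B + 1)) ^ d * (2 ^ d * 2 ^ d) := by gcongr
    _ = (24 * (B + 1)) ^ d := by rw [← mul_pow, ← mul_pow]; congr 1; ring

/-- The number of positive chips received. -/
def plusIn (m : Fin d → ChipMsg B) : ℕ := ∑ k, ((m k).1 : ℕ)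

/-- The number of messengers received. -/
def messIn (m : Fin d → ChipMsg B) : ℕ := ∑ k, ((m k).2 : ℕ)

theorem plusIn_le (m : Fin d → ChipMsg B) : plusIn m ≤ d * B := by
  simpa [plusIn] using Finset.sum_le_card_nsmul Finset.univ (fun k => ((m k).1 : ℕ)) B
    fun k _ => Nat.lt_succ_iff.1 (m k).1.2

theorem messIn_le (m : Fin d → ChipMsg B) : messIn m ≤ d * B := by
  simpa [messIn] using Finset.sum_le_card_nsmul Finset.univ (fun k => ((m k).2 : ℕ)) B
    fun k _ => Nat.lt_succ_iff.1 (m k).2.2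

variable (s : ChipState B d) (m : Fin d → ChipMsg B)

/-- The number of positive chips that are sent on. -/
def plusKept : ℕ := plusIn m - s.demand

/-- The flag after the positive chips have been processed. -/
def midFlag : Fin 3 := if s.flag = 2 ∧ 1 ≤ plusKept s m then 1 else s.flag

/-- The number of messengers that are sent on. -/
def messKept : ℕ := if midFlag s m = 1 then messIn m - 1 else messIn m

theorem plusKept_le : plusKept s m ≤ plusIn m := Nat.sub_le _ _

theorem messKept_le : messKept s m ≤ messIn m := by
  unfold messKept; split_ifs <;> omega

/-- One round of the threshold protocol at a node. -/
def step : ChipState B d × (Fin d → ChipMsg B) :=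
  (⟨⟨s.demand - plusIn m, (Nat.sub_le _ _).trans_lt s.demand.2⟩,
    if midFlag s m = 1 ∧ 1 ≤ messIn m then 0 else midFlag s m,
    if 1 ≤ messKept s m then false else if 1 ≤ plusKept s m then true else s.out,
    if 1 ≤ plusKept s m then s.plusRotor + 1 else s.plusRotor,
    if 1 ≤ messKept s m then s.messRotor + 1 else s.messRotor⟩,
   fun p => (route d B (plusKept s m) s.plusRotor p, route d B (messKept s m) s.messRotor p))

variable (B d) in
/-- The initial state and messages of a node with `w.1` positive chips and demand `w.2`. -/
def start (w : ℕ × ℕ) : ChipState B d × (Fin d → ChipMsg B) :=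
  (⟨Fin.ofNat (B + 1) w.2, 2, false, 0, 0⟩, fun p => (route d B w.1 0 p, route d B 1 0 p))

end ChipState

/-! ### Correctness of the threshold protocol -/

section Protocol

open ChipState

variable {n : ℕ} {G : SimpleGraph (Fin n)} [DecidableRel G.Adj] (P : PortLabeling G)
  (B : ℕ) (w : Fin n → ℕ × ℕ)

/-- The messages that reach node `i`. -/
def received {M : Type*} (z : ∀ i, Fin (G.degree i) → M) (i : Fin n) :
    Fin (G.degree i) → M :=
  fun k => z (PortLabeling.nbr P i k) (PortLabeling.backPort P i k)

/-- The run of the threshold protocol, from the round after its initialization. -/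
def chipRun : ℕ → ∀ i : Fin n, ChipState B (G.degree i) × (Fin (G.degree i) → ChipMsg B)
  | 0 => fun i => start B (G.degree i) (w i)
  | t + 1 => fun i => (chipRun t i).1.step (received P (fun j => (chipRun t j).2) i)

/-- The messages that reach node `i` at time `t`. -/
def chipIn (t : ℕ) (i : Fin n) : Fin (G.degree i) → ChipMsg B :=
  received P (fun j => (chipRun P B w t j).2) i

theorem chipRun_succ (t : ℕ) (i : Fin n) :
    chipRun P B w (t + 1) i = (chipRun P B w t i).1.step (chipIn P B w t i) := rfl

/-- The walk of the positive chips. -/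
def plusWalk : RotorWalk P where
  load t i p := ((chipRun P B w t i).2 p).1
  kept t i := plusKept (chipRun P B w t i).1 (chipIn P B w t i)
  rotor t i := (chipRun P B w t i).1.plusRotor
  kept_le t i := plusKept_le _ _
  sum_load t i := sum_route _ ((plusKept_le _ _).trans (plusIn_le _))
  rotor_idle t i h := by rw [chipRun_succ]; simp [step, h]
  rotor_succ t i h := by rw [chipRun_succ]; simp only [step, if_pos h]
  served t i p hp h := by
    have := one_le_route ((plusKept_le _ _).trans (plusIn_le _)) h p
    rw [hp] at this
    exact this

/-- The walk of the messengers. -/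
def messWalk : RotorWalk P where
  load t i p := ((chipRun P B w t i).2 p).2
  kept t i := messKept (chipRun P B w t i).1 (chipIn P B w t i)
  rotor t i := (chipRun P B w t i).1.messRotor
  kept_le t i := messKept_le _ _
  sum_load t i := sum_route _ ((messKept_le _ _).trans (messIn_le _))
  rotor_idle t i h := by rw [chipRun_succ]; simp [step, h]
  rotor_succ t i h := by rw [chipRun_succ]; simp only [step, if_pos h]
  served t i p hp h := by
    have := one_le_route ((messKept_le _ _).trans (messIn_le _)) h p
    rw [hp] at this
    exact this

theorem plusWalk_kept (t : ℕ) (i : Fin n) :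
    (plusWalk P B w).kept t i =
      (plusWalk P B w).arrive t i - (chipRun P B w t i).1.demand := rfl

/-- The flag of node `i` after its positive chips have been processed in round `t`. -/
def chipMidFlag (t : ℕ) (i : Fin n) : Fin 3 :=
  if (chipRun P B w t i).1.flag = 2 ∧ 1 ≤ (plusWalk P B w).kept t i then 1
  else (chipRun P B w t i).1.flag

theorem messWalk_kept (t : ℕ) (i : Fin n) :
    (messWalk P B w).kept t i = if chipMidFlag P B w t i = 1 then
      (messWalk P B w).arrive t i - 1 else (messWalk P B w).arrive t i := rfl

theorem demand_succ (t : ℕ) (i : Fin n) :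
    ((chipRun P B w (t + 1) i).1.demand : ℕ) =
      (chipRun P B w t i).1.demand - (plusWalk P B w).arrive t i := rfl

theorem flag_succ (t : ℕ) (i : Fin n) :
    (chipRun P B w (t + 1) i).1.flag =
      if chipMidFlag P B w t i = 1 ∧ 1 ≤ (messWalk P B w).arrive t i then 0
      else chipMidFlag P B w t i := rfl

theorem out_succ (t : ℕ) (i : Fin n) :
    (chipRun P B w (t + 1) i).1.out =
      if 1 ≤ (messWalk P B w).kept t i then false
      else if 1 ≤ (plusWalk P B w).kept t i then true else (chipRun P B w t i).1.out := rfl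

variable {B w}

/-- Conservation law: an absorbed chip lowers the chip count and the demand by one each. -/
theorem sum_arrive_add_demand (hd : ∀ i, 1 ≤ G.degree i) (hw : ∀ i, (w i).1 ≤ B ∧ (w i).2 ≤ B)
    (t : ℕ) : ∑ i, (plusWalk P B w).arrive t i + ∑ i, (w i).2 =
      ∑ i, (w i).1 + ∑ i, ((chipRun P B w t i).1.demand : ℕ) := by
  induction t with
  | zero =>
    rw [sum_inflow]
    congr 1
    · refine Finset.sum_congr rfl fun i _ => ?_
      exact sum_route _ ((hw i).1.trans (Nat.le_mul_of_pos_left _ (hd i)))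
    · refine Finset.sum_congr rfl fun i _ => ?_
      exact (Nat.mod_eq_of_lt (Nat.lt_succ_iff.2 (hw i).2)).symm
  | succ t ih =>
    have h : ∑ i, (plusWalk P B w).kept t i + ∑ i, ((chipRun P B w t i).1.demand : ℕ) =
        ∑ i, (plusWalk P B w).arrive t i + ∑ i, ((chipRun P B w (t + 1) i).1.demand : ℕ) := by
      rw [← Finset.sum_add_distrib, ← Finset.sum_add_distrib]
      refine Finset.sum_congr rfl fun i _ => ?_
      rw [plusWalk_kept, demand_succ]
      omega
    rw [RotorWalk.sum_arrive_succ]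
    omega

/-- A node sends a chip on only after its demand is met, so no chip has yet passed. -/
theorem flag_of_demand (t : ℕ) (i : Fin n) (h : 1 ≤ ((chipRun P B w t i).1.demand : ℕ)) :
    (chipRun P B w t i).1.flag = 2 := by
  induction t with
  | zero => rfl
  | succ t ih =>
    rw [demand_succ] at h
    have h2 := ih (by omega)
    have h0 : (plusWalk P B w).kept t i = 0 := by rw [plusWalk_kept]; omega
    simp [flag_succ, chipMidFlag, h0, h2]

/-- The last flag to leave `2` does so because a chip passes on. From then on no demand is left
anywhere, so no chip is absorbed. -/
theorem arrive_or_flag (hn : n ≠ 0) (t : ℕ) :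
    1 ≤ ∑ i, (plusWalk P B w).arrive t i ∨ ∃ i, (chipRun P B w t i).1.flag = 2 := by
  induction t with
  | zero => exact Or.inr ⟨⟨0, by omega⟩, rfl⟩
  | succ t ih =>
    by_contra! hcon
    obtain ⟨h0, hf⟩ := hcon
    rw [RotorWalk.sum_arrive_succ, Nat.lt_one_iff, Finset.sum_eq_zero_iff] at h0
    have hmid : ∀ i, (chipRun P B w t i).1.flag ≠ 2 := by
      intro i hi
      refine hf i ?_
      simp [flag_succ, chipMidFlag, h0 i (Finset.mem_univ i), hi]
    rcases ih with h1 | ⟨i, hi⟩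
    · refine absurd h1 ?_
      rw [Finset.sum_eq_zero]
      · omega
      · intro i _
        have hk := h0 i (Finset.mem_univ i)
        rw [plusWalk_kept] at hk
        by_contra hne
        exact hmid i (flag_of_demand P t i (by omega))
    · exact hmid i hi

/-- Every node starts with one messenger, and its flag drops to `0` exactly when it absorbs one. -/
theorem sum_mess_eq (hd : ∀ i, 1 ≤ G.degree i) (hB : 1 ≤ B) (t : ℕ) :
    ∑ i, (messWalk P B w).arrive t i = ∑ i, if (chipRun P B w t i).1.flag = 0 then 0 else 1 := by
  induction t with
  | zero =>
    rw [sum_inflow]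
    refine Finset.sum_congr rfl fun i _ => ?_
    exact sum_route _ (hB.trans (Nat.le_mul_of_pos_left _ (hd i)))
  | succ t ih =>
    have h : ∑ i, (messWalk P B w).kept t i +
          ∑ i, (if (chipRun P B w t i).1.flag = 0 then 0 else 1) =
        ∑ i, (messWalk P B w).arrive t i +
          ∑ i, if (chipRun P B w (t + 1) i).1.flag = 0 then 0 else 1 := by
      rw [← Finset.sum_add_distrib, ← Finset.sum_add_distrib]
      refine Finset.sum_congr rfl fun i _ => ?_
      rw [messWalk_kept, flag_succ]
      have h0 : (chipRun P B w t i).1.flag = 0 ↔ chipMidFlag P B w t i = 0 := by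
        unfold chipMidFlag
        split_ifs with h
        · simp [h.1]
        · rfl
      rw [if_congr h0 rfl rfl]
      by_cases h1 : chipMidFlag P B w t i = 1
      · by_cases h2 : 1 ≤ (messWalk P B w).arrive t i
        · simp [h1, h2]
        · simp [h1, h2]; omega
      · simp [h1]
    rw [RotorWalk.sum_arrive_succ]
    omega

/-- A property that is set infinitely often and never lost holds eventually. -/
theorem eventually_of_frequently_of_persistent {p : ℕ → Prop} (T : ℕ)
    (h : ∃ t ≥ T, p t) (hp : ∀ t ≥ T, p t → p (t + 1)) : ∀ᶠ t in atTop, p t := by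
  obtain ⟨t, ht, h0⟩ := h
  refine eventually_atTop.2 ⟨t, fun s hs => ?_⟩
  induction s, hs using Nat.le_induction with
  | base => exact h0
  | succ s hs ih => exact hp s (by omega) ih

/-- The threshold protocol decides whether there are more positive chips than demands. -/
theorem chipRun_out (hG : G.Connected) (hd : ∀ i, 1 ≤ G.degree i) (hB : 1 ≤ B)
    (hw : ∀ i, (w i).1 ≤ B ∧ (w i).2 ≤ B) :
    ∀ᶠ t in atTop, ∀ i,
      (chipRun P B w t i).1.out = decide (∑ i, (w i).2 < ∑ i, (w i).1) := by
  have hn : n ≠ 0 := by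
    rintro rfl
    exact hG.nonempty.elim fun i => i.elim0
  rw [eventually_all]
  intro i
  rcases (plusWalk P B w).extinct_or_recurrent hG with ⟨T, hT⟩ | ⟨T, hTk, hTr⟩
  · have hdec : ¬ ∑ i, (w i).2 < ∑ i, (w i).1 := by
      have := sum_arrive_add_demand P hd hw T
      rw [Finset.sum_eq_zero fun i _ => hT T le_rfl i] at this
      omega
    have hk : ∀ t ≥ T, ∀ i, (plusWalk P B w).kept t i = 0 := fun t ht i =>
      Nat.le_zero.1 (((plusWalk P B w).kept_le t i).trans (hT t ht i).le)
    rw [decide_eq_false hdec]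
    rcases (messWalk P B w).extinct_or_recurrent hG with ⟨T', hT'⟩ | ⟨T', hTk', hTr'⟩
    -- With the chips gone some flag is still `2`, so the messenger count cannot be zero.
    · exfalso
      have h1 := sum_mess_eq (w := w) P hd hB (max T T')
      rw [Finset.sum_eq_zero fun i _ => hT' _ (le_max_right _ _) i] at h1
      rcases arrive_or_flag (w := w) (B := B) P hn (max T T') with h2 | ⟨j, hj⟩
      · rw [Finset.sum_eq_zero fun i _ => hT _ (le_max_left _ _) i] at h2
        omega
      · have := (Finset.sum_eq_zero_iff.1 h1.symm) j (Finset.mem_univ j)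
        simp [hj] at this
    · obtain ⟨t, ht, h1⟩ := hTr' i (max T T')
      refine eventually_of_frequently_of_persistent T ⟨t + 1, by omega, ?_⟩ fun s hs h => ?_
      · rw [out_succ, if_pos (by rw [hTk' t (by omega)]; exact h1)]
      · rw [out_succ, hk s hs i]
        simp [h]
  -- Chips survive. After `T` nothing is absorbed although every node is visited, so every demand is
  -- already `0`.
  · have hdem : ∀ j, ((chipRun P B w T j).1.demand : ℕ) = 0 := by
      intro j
      have hconst : ∀ s, ((chipRun P B w (T + s) j).1.demand : ℕ) =
          (chipRun P B w T j).1.demand := by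
        intro s
        induction s with
        | zero => rfl
        | succ s ih =>
          have hk := hTk (T + s) (by omega) j
          rw [plusWalk_kept] at hk
          rw [← add_assoc, demand_succ]
          omega
      obtain ⟨t, ht, h1⟩ := hTr j T
      obtain ⟨s, rfl⟩ := Nat.exists_eq_add_of_le ht
      have hk := hTk _ ht j
      rw [plusWalk_kept] at hk
      have := hconst s
      omega
    have hdec : ∑ i, (w i).2 < ∑ i, (w i).1 := by
      have h1 := sum_arrive_add_demand P hd hw T
      rw [Finset.sum_eq_zero (f := fun i => ((chipRun P B w T i).1.demand : ℕ))
        fun i _ => hdem i] at h1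
      by_contra hcon
      have h0 : ∑ i, (plusWalk P B w).arrive T i = 0 := by omega
      obtain ⟨t, ht, h2⟩ := hTr i T
      have h3 := (plusWalk P B w).sum_arrive_antitone ht
      have h4 := Finset.single_le_sum (f := fun i => (plusWalk P B w).arrive t i)
        (fun _ _ => Nat.zero_le _) (Finset.mem_univ i)
      simp only at h3 h4
      omega
    rw [decide_eq_true hdec]
    have hflag : ∀ j, ∀ᶠ t in atTop, (chipRun P B w t j).1.flag ≠ 2 := by
      intro j
      obtain ⟨t, ht, h1⟩ := hTr j T
      refine eventually_of_frequently_of_persistent 0 ⟨t + 1, by omega, ?_⟩ fun s _ h => ?_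
      · have hm : chipMidFlag P B w t j ≠ 2 := by
          unfold chipMidFlag
          rw [hTk t ht j]
          split_ifs with h
          · decide
          · exact fun h' => h ⟨h', h1⟩
        rw [flag_succ]
        split_ifs
        · decide
        · exact hm
      · rw [flag_succ]
        unfold chipMidFlag
        split_ifs <;> first | decide | exact h
    rcases (messWalk P B w).extinct_or_recurrent hG with ⟨T', hT'⟩ | ⟨T', hTk', hTr'⟩
    · have hk : ∀ t ≥ T', (messWalk P B w).kept t i = 0 := fun t ht =>
        Nat.le_zero.1 (((messWalk P B w).kept_le t i).trans (hT' t ht i).le)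
      obtain ⟨t, ht, h1⟩ := hTr i (max T T')
      refine eventually_of_frequently_of_persistent T' ⟨t + 1, by omega, ?_⟩ fun s hs h => ?_
      · rw [out_succ, hk t (by omega), hTk t (by omega)]
        simp [h1]
      · rw [out_succ, hk s hs]
        simp [h]
    -- Surviving messengers would visit every node without loss. A visited node with flag `1` would
    -- absorb one, so all flags end at `0`, and then the count leaves no messenger.
    · exfalso
      have hzero : ∀ j, ∀ᶠ t in atTop, (chipRun P B w t j).1.flag = 0 := by
        intro j
        obtain ⟨S, hS⟩ := eventually_atTop.1 (hflag j)
        obtain ⟨t, ht, h1⟩ := hTr' j (max S T')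
        refine eventually_of_frequently_of_persistent 0 ⟨t, by omega, ?_⟩ fun s _ h => ?_
        · have hk := hTk' t (by omega) j
          have h2 := hS t (by omega)
          have hm : chipMidFlag P B w t j = (chipRun P B w t j).1.flag := by
            unfold chipMidFlag
            rw [if_neg fun h => h2 h.1]
          rw [messWalk_kept, hm] at hk
          have hf1 : (chipRun P B w t j).1.flag ≠ 1 := by
            intro h
            rw [if_pos h] at hk
            omega
          generalize (chipRun P B w t j).1.flag = f at h2 hf1
          fin_cases f <;> simp_all
        · rw [flag_succ]
          simp [chipMidFlag, h]
      obtain ⟨S, hS⟩ := eventually_atTop.1 (eventually_all.2 hzero)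
      obtain ⟨t, ht, h1⟩ := hTr' i S
      have h2 := sum_mess_eq (w := w) P hd hB t
      rw [Finset.sum_eq_zero (f := fun j => if (chipRun P B w t j).1.flag = 0 then 0 else 1)
        fun j _ => if_pos (hS t ht j), Finset.sum_eq_zero_iff] at h2
      have := h2 i (Finset.mem_univ i)
      omega

end Protocol

open Filter ChipState

/-! ### Realization by automata with linear memory -/

section Automaton

variable {X Y : Type*} {J : Type} [Finite J] (B : ℕ) (w : J → X → ℕ × ℕ)

/-- One round, at a node of degree `d`, of the parallel execution of the threshold protocols with
initial data `w j`. The memory is `none` before the initialization. -/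
def chipAdvance (d : ℕ) (x : X) (s : Option (J → ChipState B d)) (m : Fin d → J → ChipMsg B)
    (j : J) : ChipState B d × (Fin d → ChipMsg B) :=
  match s with
  | none => start B d (w j x)
  | some s => (s j).step fun k => m k j

variable (J) in
/-- The memory of the parallel execution. A node of degree `0` has no memory. -/
abbrev ChipMem (d : ℕ) : Type := {s : Option (J → ChipState B d) // d = 0 → s = none}

/-- At `d = 0` the bound permits a single state, which is why `ChipMem` excludes `some` there. -/
theorem card_chipMem_le (d : ℕ) :
    Nat.card (ChipMem J B d) ≤ ((24 * (B + 1)) ^ Nat.card J + 1) ^ d := by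
  rcases Nat.eq_zero_or_pos d with rfl | hd
  · have : Subsingleton (ChipMem J B 0) :=
      ⟨fun a b => Subtype.ext ((a.2 rfl).trans (b.2 rfl).symm)⟩
    rw [pow_zero]
    exact Finite.card_le_one_iff_subsingleton.2 this
  · calc Nat.card (ChipMem J B d) ≤ Nat.card (Option (J → ChipState B d)) :=
          Nat.card_le_card_of_injective _ Subtype.val_injective
      _ = Nat.card (ChipState B d) ^ Nat.card J + 1 := by
          rw [Finite.card_option, Nat.card_fun]
      _ ≤ ((24 * (B + 1)) ^ Nat.card J) ^ d + 1 := by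
          rw [← pow_mul, mul_comm (Nat.card J), pow_mul]
          gcongr
          exact ChipState.card_le hd
      _ ≤ ((24 * (B + 1)) ^ Nat.card J + 1) ^ d := Nat.pow_lt_pow_left (Nat.lt_succ_self _) hd.ne'

/-- The automata that execute the threshold protocols with initial data `w j` in parallel and
combine their outputs by `F`. A node without neighbors with initial value `x` outputs `F₀ x`. -/
def chipAutomaton (F : (J → Bool) → Y) (F₀ : X → Y) : AutomatonFamily X Y where
  Msg := J → ChipMsg B
  Mem := ChipMem J B
  finite_msg := inferInstance
  finite_mem _ := inferInstance
  msg₀ := fun _ => 0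
  mem₀ _ := ⟨none, fun _ => rfl⟩
  next d x s _ m :=
    if h : d = 0 then (⟨none, fun _ => rfl⟩, F₀ x, fun _ _ => 0)
    else (⟨some fun j => (chipAdvance B w d x s.1 m j).1, fun h' => absurd h' h⟩,
      F fun j => (chipAdvance B w d x s.1 m j).1.out, fun p j => (chipAdvance B w d x s.1 m j).2 p)
  memory_bound := by
    refine ⟨Real.log (((24 * (B + 1)) ^ Nat.card J + 1 : ℕ) : ℝ), fun d => ?_⟩
    have : Nonempty (ChipMem J B d) := ⟨⟨none, fun _ => rfl⟩⟩
    rw [mul_comm, ← Real.log_pow]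
    refine Real.log_le_log (by exact_mod_cast Nat.card_pos) ?_
    exact_mod_cast card_chipMem_le B d

variable {n : ℕ} {G : SimpleGraph (Fin n)} [DecidableRel G.Adj] (P : PortLabeling G)

/-- Round `0` of the automaton only loads the initial data, hence the shift by one. -/
theorem run_chipAutomaton (F : (J → Bool) → Y) (F₀ : X → Y) (y₀ : Y) (x : Fin n → X)
    (hd : ∀ i, G.degree i ≠ 0) (t : ℕ) (i : Fin n) :
    (run (chipAutomaton B w F F₀) y₀ G P x (t + 1) i).mem.1 =
        some (fun j => (chipRun P B (fun i => w j (x i)) t i).1) ∧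
      (run (chipAutomaton B w F F₀) y₀ G P x (t + 1) i).out =
        F (fun j => (chipRun P B (fun i => w j (x i)) t i).1.out) ∧
      (run (chipAutomaton B w F F₀) y₀ G P x (t + 1) i).msg =
        fun p j => (chipRun P B (fun i => w j (x i)) t i).2 p := by
  induction t generalizing i with
  | zero =>
    rw [run]
    simp only [chipAutomaton, dif_neg (hd i)]
    exact ⟨rfl, rfl, rfl⟩
  | succ t ih =>
    have key : ∀ j, chipAdvance B w (G.degree i) (x i)
        (run (chipAutomaton B w F F₀) y₀ G P x (t + 1) i).mem.1
        (fun k => (run (chipAutomaton B w F F₀) y₀ G P x (t + 1) (PortLabeling.nbr P i k)).msg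
          (PortLabeling.backPort P i k)) j =
        chipRun P B (fun i => w j (x i)) (t + 1) i := by
      intro j
      rw [(ih i).1]
      simp only [(ih _).2.2]
      rfl
    simp only [← key]
    rw [run]
    simp only [chipAutomaton, dif_neg (hd i), and_self]

end Automaton

/-- A combination of finitely many linear threshold tests is computable. -/
theorem familyComputable_of_thresholds {X Y J : Type*} [Finite X] [Finite J] (y₀ : Y)
    (w : J → X → ℤ) (F : (J → Bool) → Y) (f : ∀ n : ℕ, (Fin n → X) → Y)
    (hf : ∀ n ≠ 0, ∀ x : Fin n → X, f n x = F fun j => decide (0 < ∑ i, w j (x i))) :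
    FamilyComputable y₀ f := by
  classical
  obtain ⟨N, ⟨e⟩⟩ := Finite.exists_equiv_fin J
  let v : Fin N → X → ℕ × ℕ := fun j x => ((w (e.symm j) x).toNat, (-w (e.symm j) x).toNat)
  obtain ⟨B, hB⟩ : ∃ B : ℕ, ∀ j x, (w j x).natAbs ≤ B := by
    obtain ⟨B, hB⟩ := Set.Finite.bddAbove
      (Set.finite_range fun a : J × X => (w a.1 a.2).natAbs)
    exact ⟨B, fun j x => hB ⟨(j, x), rfl⟩⟩
  -- Capacity `B + 1` leaves room for a messenger even if all weights vanish. A lone node knows the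
  -- whole input and outputs `f 1` directly.
  refine ⟨chipAutomaton (B + 1) v (fun b => F fun j => b (e j)) (fun x => f 1 fun _ => x), ?_⟩
  intro n G _ hG P x
  have hn : n ≠ 0 := by
    rintro rfl
    exact hG.nonempty.elim fun i => i.elim0
  by_cases h1 : n = 1
  · subst h1
    refine ⟨1, fun t ht i => ?_⟩
    obtain ⟨s, rfl⟩ := Nat.exists_eq_add_of_le' ht
    have hd : G.degree i = 0 := by
      have := G.degree_lt_card_verts i
      rw [Fintype.card_fin] at this
      omega
    rw [run]
    simp only [chipAutomaton, dif_pos hd]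
    exact congrArg _ (funext fun k => congrArg x (Subsingleton.elim _ _))
  · have : Nontrivial (Fin n) := Fin.nontrivial_iff_two_le.2 (by omega)
    have hd : ∀ i, 1 ≤ G.degree i := fun i => hG.preconnected.degree_pos_of_nontrivial i
    have hev : ∀ᶠ t in atTop, ∀ j i,
        (chipRun P (B + 1) (fun i => v j (x i)) t i).1.out =
          decide (∑ i, (v j (x i)).2 < ∑ i, (v j (x i)).1) := by
      rw [eventually_all]
      intro j
      refine chipRun_out P hG hd (by omega) fun i => ?_
      have := hB (e.symm j) (x i)
      simp only [v]
      omega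
    obtain ⟨T, hT⟩ := eventually_atTop.1 hev
    refine ⟨T + 1, fun t ht i => ?_⟩
    obtain ⟨s, rfl⟩ := Nat.exists_eq_add_of_le' (show 1 ≤ t by omega)
    rw [(run_chipAutomaton (B + 1) v P _ _ y₀ x (fun i => by have := hd i; omega) s i).2.1, hf n hn]
    congr 1
    funext j
    refine (hT s (by omega) (e j) i).trans ?_
    refine decide_eq_decide.2 ?_
    have hsum : ∑ i, w j (x i) = (∑ i, (v (e j) (x i)).1 : ℕ) - (∑ i, (v (e j) (x i)).2 : ℕ) := by
      push_cast
      rw [← Finset.sum_sub_distrib]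
      refine Finset.sum_congr rfl fun i _ => ?_
      simp only [v, Equiv.symm_apply_apply]
      omega
    rw [hsum]
    omega

/-! ### Box functions are computable -/

section Boxes

variable {K : ℕ}

/-- Multiplication by `n * a.den` gives an integer inequality whose summands each depend on one
initial value, not on `n`. -/
theorem rat_lt_freq_iff {n : ℕ} (hn : n ≠ 0) (x : Fin n → Fin K) (k : Fin K) (a : ℚ) :
    (a : ℝ) < freq x k ↔ 0 < ∑ i, ((if x i = k then (a.den : ℤ) else 0) - a.num) := by
  have hn' : (0 : ℝ) < n := by exact_mod_cast Nat.pos_of_ne_zero hn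
  have hd : (0 : ℝ) < a.den := by exact_mod_cast a.den_pos
  rw [← @Int.cast_lt ℝ]
  push_cast
  rw [Finset.sum_sub_distrib, ← Finset.sum_filter, Finset.sum_const, Finset.sum_const]
  simp only [freq, Finset.card_univ, Fintype.card_fin, nsmul_eq_mul]
  rw [lt_div_iff₀ hn', Rat.cast_def, div_mul_eq_mul_div, div_lt_iff₀ hd, sub_pos,
    mul_comm (n : ℝ)]

theorem freq_lt_rat_iff {n : ℕ} (hn : n ≠ 0) (x : Fin n → Fin K) (k : Fin K) (a : ℚ) :
    freq x k < (a : ℝ) ↔ 0 < ∑ i, (a.num - (if x i = k then (a.den : ℤ) else 0)) := by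
  have hn' : (0 : ℝ) < n := by exact_mod_cast Nat.pos_of_ne_zero hn
  have hd : (0 : ℝ) < a.den := by exact_mod_cast a.den_pos
  rw [← @Int.cast_lt ℝ]
  push_cast
  rw [Finset.sum_sub_distrib, ← Finset.sum_filter, Finset.sum_const, Finset.sum_const]
  simp only [freq, Finset.card_univ, Fintype.card_fin, nsmul_eq_mul]
  rw [div_lt_iff₀ hn', Rat.cast_def, div_mul_eq_mul_div, lt_div_iff₀ hd, sub_pos,
    mul_comm (n : ℝ)]

/-- Membership in the boxes, hence the value of `g`, depends only on finitely many strict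
comparisons of coordinates with rationals. -/
theorem IsBoxFunction.isComputable {R : Type*} [AddCommGroup R] {Y : Set R} (y₀ : Y)
    {g : proportionSet K → Y} (hg : IsBoxFunction g) : IsComputable y₀ g := by
  classical
  obtain ⟨N, c, a, b, hg⟩ := hg
  let bits : proportionSet K → Fin N × Fin K × Bool → Bool := fun p j =>
    if j.2.2 then decide ((a j.1 j.2.1 : ℝ) < p.1 j.2.1)
    else decide (p.1 j.2.1 < (b j.1 j.2.1 : ℝ))
  have hfac : g.FactorsThrough bits := by
    intro p q hpq
    refine Subtype.ext ?_
    rw [hg, hg]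
    refine Finset.sum_congr rfl fun i _ => ?_
    have hmem : (p : EuclideanSpace ℝ (Fin K)) ∈ rationalBox (a i) (b i) ↔
        (q : EuclideanSpace ℝ (Fin K)) ∈ rationalBox (a i) (b i) := by
      refine forall_congr' fun k => and_congr ?_ ?_
      · have := congrFun hpq (i, k, true)
        simpa [bits] using this
      · have := congrFun hpq (i, k, false)
        simpa [bits] using this
    simp only [Set.indicator_apply, hmem]
  refine ⟨fun n x => if hn : n ≠ 0 then g ⟨freq x, freq_mem hn x⟩ else y₀,
    fun n hn x => dif_pos hn, ?_⟩
  refine familyComputable_of_thresholds (J := Fin N × Fin K × Bool) y₀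
    (fun j l => if j.2.2 then (if l = j.2.1 then ((a j.1 j.2.1).den : ℤ) else 0) - (a j.1 j.2.1).num
      else (b j.1 j.2.1).num - (if l = j.2.1 then ((b j.1 j.2.1).den : ℤ) else 0))
    -- `y₀` is a dummy value for bit patterns that no point of the simplex realizes.
    (Function.extend bits g fun _ => y₀) _ fun n hn x => ?_
  rw [dif_pos hn, ← hfac.extend_apply (fun _ => y₀)]
  congr 1
  funext ⟨i, k, u⟩
  cases u
  · simp only [bits, Bool.false_eq_true, if_false, freq_lt_rat_iff hn]
  · simp only [bits, if_true, rat_lt_freq_iff hn]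

end Boxes

/-! ### Finiteness of the volume of the simplex -/

section SimplexVolume

/-- The coordinates sum to `1`, so the dropped coordinate varies by at most `K` times the sup
distance of the others. -/
theorem exists_antilipschitzWith_tail (K : ℕ) : ∃ C : NNReal, AntilipschitzWith C
    (fun (p : proportionSet (K + 1)) (k : Fin K) => (p : EuclideanSpace ℝ (Fin (K + 1))) k.succ) := by
  let C : NNReal := (Fintype.card (Fin (K + 1)) : NNReal) ^ (1 / (2 : ENNReal)).toReal
  refine ⟨C * (K + 1), AntilipschitzWith.of_le_mul_dist fun p q => ?_⟩
  have hC : dist p q ≤ C * dist (WithLp.ofLp p.1) (WithLp.ofLp q.1) :=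
    (PiLp.antilipschitzWith_ofLp 2 (fun _ : Fin (K + 1) => ℝ)).le_mul_dist p.1 q.1
  refine hC.trans ?_
  rw [NNReal.coe_mul, mul_assoc]
  refine mul_le_mul_of_nonneg_left ?_ C.2
  set D := dist (fun k : Fin K => p.1 k.succ) (fun k => q.1 k.succ) with hD
  have hD0 : 0 ≤ D := dist_nonneg
  have hk : ∀ k : Fin K, |p.1 k.succ - q.1 k.succ| ≤ D := fun k => by
    rw [← Real.dist_eq]
    exact dist_le_pi_dist (fun k : Fin K => p.1 k.succ) (fun k => q.1 k.succ) k
  refine (dist_pi_le_iff (by positivity)).2 fun k => ?_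
  push_cast
  rw [Real.dist_eq]
  refine Fin.cases ?_ (fun k => ?_) k
  · have hp := p.2.2
    have hq := q.2.2
    rw [Fin.sum_univ_succ] at hp hq
    have : p.1 0 - q.1 0 = ∑ k : Fin K, -(p.1 k.succ - q.1 k.succ) := by
      simp only [neg_sub, Finset.sum_sub_distrib]
      linarith
    calc |p.1 0 - q.1 0| ≤ ∑ k : Fin K, |-(p.1 k.succ - q.1 k.succ)| := by
          rw [this]; exact Finset.abs_sum_le_sum_abs _ _
      _ ≤ ∑ _k : Fin K, D := Finset.sum_le_sum fun k _ => by rw [abs_neg]; exact hk k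
      _ ≤ (K + 1) * D := by simp; linarith
  · exact (hk k).trans (le_mul_of_one_le_left hD0 (by linarith [(K.cast_nonneg : (0 : ℝ) ≤ K)]))

/-- The simplex is the preimage of the unit cube of `ℝ ^ K` under an antilipschitz map, so its
Hausdorff measure is at most a constant times the volume of the cube. For no coordinates at all it
is empty. -/
instance isFiniteMeasure_proportionVolume (K : ℕ) : IsFiniteMeasure (proportionVolume K) := by
  constructor
  rcases K with _ | K
  · have : IsEmpty (proportionSet 0) := ⟨fun p => by simpa using p.2.2⟩
    rw [Set.univ_eq_empty_iff.2 this, measure_empty]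
    exact ENNReal.zero_lt_top
  · obtain ⟨C, hC⟩ := exists_antilipschitzWith_tail K
    have h1 := hC.hausdorffMeasure_preimage_le (d := K) (by positivity) (Set.Icc 0 1)
    have h2 : (fun (p : proportionSet (K + 1)) (k : Fin K) =>
        (p : EuclideanSpace ℝ (Fin (K + 1))) k.succ) ⁻¹' Set.Icc 0 1 = Set.univ :=
      Set.eq_univ_of_forall fun p => ⟨fun k => (p.2.1 k.succ).1, fun k => (p.2.1 k.succ).2⟩
    have h3 : (Measure.hausdorffMeasure (K : ℝ) : Measure (Fin K → ℝ)) = volume := by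
      simpa using hausdorffMeasure_pi_real (ι := Fin K)
    rw [h2, h3] at h1
    rw [proportionVolume, Measure.euclideanHausdorffMeasure_def, Measure.smul_apply]
    refine ENNReal.mul_lt_top ENNReal.coe_lt_top (h1.trans_lt (ENNReal.mul_lt_top ?_ ?_))
    · exact ENNReal.rpow_lt_top_of_nonneg (by positivity) ENNReal.coe_ne_top
    · exact isCompact_Icc.measure_lt_top

end SimplexVolume

/-! ### The algebra of sets generated by boxes -/

section BoxAlgebra

variable {K : ℕ} {R : Type*} [AddCommGroup R]

/-- The trace of a rational box on the proportion set. -/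
def boxTrace (a b : Fin K → ℚ) : Set (proportionSet K) := Subtype.val ⁻¹' rationalBox a b

/-- The functions on the proportion set that are finite sums of multiples of indicators of boxes. -/
def IsBoxSum (φ : proportionSet K → R) : Prop :=
  ∃ (N : ℕ) (c : Fin N → R) (a b : Fin N → Fin K → ℚ),
    ∀ p, φ p = ∑ i, (rationalBox (a i) (b i)).indicator (fun _ => c i)
      (p : EuclideanSpace ℝ (Fin K))

theorem IsBoxSum.zero : IsBoxSum (fun _ : proportionSet K => (0 : R)) :=
  ⟨0, Fin.elim0, Fin.elim0, Fin.elim0, fun _ => by simp⟩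

theorem IsBoxSum.add {φ ψ : proportionSet K → R} (hφ : IsBoxSum φ) (hψ : IsBoxSum ψ) :
    IsBoxSum (fun p => φ p + ψ p) := by
  obtain ⟨N, c, a, b, h⟩ := hφ
  obtain ⟨N', c', a', b', h'⟩ := hψ
  exact ⟨N + N', Fin.append c c', Fin.append a a', Fin.append b b', fun p => by
    simp [Fin.sum_univ_add, h, h']⟩

theorem IsBoxSum.sum {ι : Type*} (s : Finset ι) {φ : ι → proportionSet K → R}
    (h : ∀ i ∈ s, IsBoxSum (φ i)) : IsBoxSum (fun p => ∑ i ∈ s, φ i p) := by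
  classical
  induction s using Finset.induction_on with
  | empty => simpa using IsBoxSum.zero
  | insert i s hi ih =>
    simp only [Finset.sum_insert hi]
    exact (h i (Finset.mem_insert_self i s)).add
      (ih fun j hj => h j (Finset.mem_insert_of_mem hj))

variable (K) in
/-- The integer combinations of indicators of boxes. -/
def boxGroup : AddSubgroup (proportionSet K → ℤ) :=
  AddSubgroup.closure {φ | ∃ a b, φ = (boxTrace a b).indicator 1}

theorem indicator_boxTrace_mem (a b : Fin K → ℚ) :
    (boxTrace a b).indicator 1 ∈ boxGroup K :=
  AddSubgroup.subset_closure ⟨a, b, rfl⟩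

theorem boxTrace_inter (a b a' b' : Fin K → ℚ) :
    boxTrace a b ∩ boxTrace a' b' = boxTrace (a ⊔ a') (b ⊓ b') := by
  ext p
  simp only [boxTrace, rationalBox, Set.mem_inter_iff, Set.mem_preimage, Set.mem_ofPred_eq,
    Set.mem_Ioo, ← forall_and, Pi.sup_apply, Pi.inf_apply, Rat.cast_max, Rat.cast_min,
    max_lt_iff, lt_min_iff]
  exact forall_congr' fun k => by tauto

/-- By bilinearity it suffices to multiply two box indicators, and boxes are closed under
intersection. -/
theorem mul_mem_boxGroup {φ ψ : proportionSet K → ℤ} (hφ : φ ∈ boxGroup K)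
    (hψ : ψ ∈ boxGroup K) : φ * ψ ∈ boxGroup K := by
  induction hφ using AddSubgroup.closure_induction with
  | zero => rw [zero_mul]; exact zero_mem _
  | add _ _ _ _ h1 h2 => rw [add_mul]; exact add_mem h1 h2
  | neg _ _ h1 => rw [neg_mul]; exact neg_mem h1
  | mem φ hφ =>
    obtain ⟨a, b, rfl⟩ := hφ
    induction hψ using AddSubgroup.closure_induction with
    | zero => rw [mul_zero]; exact zero_mem _
    | add _ _ _ _ h1 h2 => rw [mul_add]; exact add_mem h1 h2
    | neg _ _ h1 => rw [mul_neg]; exact neg_mem h1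
    | mem ψ hψ =>
      obtain ⟨a', b', rfl⟩ := hψ
      rw [← Set.inter_indicator_one, boxTrace_inter]
      exact indicator_boxTrace_mem _ _

/-- `R` has no product, so the set algebra is done over `ℤ` and moved to `R` by the action on `c`.
-/
theorem isBoxSum_of_mem_boxGroup {φ : proportionSet K → ℤ} (hφ : φ ∈ boxGroup K) (c : R) :
    IsBoxSum (fun p => φ p • c) := by
  induction hφ using AddSubgroup.closure_induction generalizing c with
  | zero => simpa using IsBoxSum.zero
  | add _ _ _ _ h1 h2 => simpa [add_smul] using (h1 c).add (h2 c)
  | neg _ _ h1 => simpa using h1 (-c)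
  | mem φ hφ =>
    obtain ⟨a, b, rfl⟩ := hφ
    refine ⟨1, fun _ => c, fun _ => a, fun _ => b, fun p => ?_⟩
    by_cases hp : p ∈ boxTrace a b
    · have hp' : p.1 ∈ rationalBox a b := hp
      simp [hp, hp']
    · have hp' : p.1 ∉ rationalBox a b := hp
      simp [hp, hp']

variable (K) in
/-- The sets whose indicators are integer combinations of indicators of boxes. -/
def boxAlgebra : Set (Set (proportionSet K)) := {S | S.indicator 1 ∈ boxGroup K}

theorem isBoxSum_indicator {S : Set (proportionSet K)} (hS : S ∈ boxAlgebra K) (c : R) :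
    IsBoxSum (S.indicator fun _ => c) := by
  convert isBoxSum_of_mem_boxGroup hS c using 2 with p
  by_cases hp : p ∈ S <;> simp [hp]

theorem boxTrace_mem_boxAlgebra (a b : Fin K → ℚ) : boxTrace a b ∈ boxAlgebra K :=
  indicator_boxTrace_mem a b

theorem boxTrace_neg_one_two : boxTrace (K := K) (fun _ => -1) (fun _ => 2) = Set.univ :=
  Set.eq_univ_of_forall fun p k => by
    have := p.2.1 k
    constructor
    · push_cast; linarith [this.1]
    · push_cast; linarith [this.2]

variable (K) in
-- Complements are `1 - φ` and unions follow from inclusion-exclusion; `1` is available because the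
-- box `(-1, 2) ^ K` contains the simplex.
theorem isSetAlgebra_boxAlgebra : IsSetAlgebra (boxAlgebra K) := by
  have hone : (1 : proportionSet K → ℤ) ∈ boxGroup K := by
    have := indicator_boxTrace_mem (K := K) (fun _ => -1) (fun _ => 2)
    rwa [boxTrace_neg_one_two, Set.indicator_univ] at this
  refine ⟨?_, fun S hS => ?_, fun S T hS hT => ?_⟩
  · rw [boxAlgebra, Set.mem_ofPred_eq, Set.indicator_empty]
    exact zero_mem _
  · rw [boxAlgebra, Set.mem_ofPred_eq, Set.indicator_compl]
    exact sub_mem hone hS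
  · rw [boxAlgebra, Set.mem_ofPred_eq, eq_sub_of_add_eq
      (Set.indicator_union_add_inter (1 : proportionSet K → ℤ) S T), Set.inter_indicator_one]
    exact sub_mem (add_mem hS hT) (mul_mem_boxGroup hS hT)

theorem measurableSet_boxTrace (a b : Fin K → ℚ) : MeasurableSet (boxTrace a b) := by
  have : boxTrace a b = ⋂ k, {p : proportionSet K | p.1 k ∈ Set.Ioo (a k : ℝ) (b k)} := by
    ext p; simp [boxTrace, rationalBox]
  rw [this]
  refine MeasurableSet.iInter fun k => measurableSet_Ioo.preimage ?_
  fun_prop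

theorem measurable_of_mem_boxGroup {φ : proportionSet K → ℤ} (hφ : φ ∈ boxGroup K) :
    Measurable φ := by
  induction hφ using AddSubgroup.closure_induction with
  | zero => exact measurable_const
  | add _ _ _ _ h1 h2 => exact h1.add h2
  | neg _ _ h1 => exact h1.neg
  | mem φ hφ =>
    obtain ⟨a, b, rfl⟩ := hφ
    exact measurable_one.indicator (measurableSet_boxTrace a b)

variable (K) in
-- On the simplex a rational half-space `r < p k` is the trace of a box, and these half-spaces make
-- all coordinates measurable.
theorem generateFrom_boxAlgebra :
    (inferInstance : MeasurableSpace (proportionSet K)) =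
      MeasurableSpace.generateFrom (boxAlgebra K) := by
  apply le_antisymm
  · have hid : @Measurable _ _ (MeasurableSpace.generateFrom (boxAlgebra K)) inferInstance
        (id : proportionSet K → proportionSet K) := by
      let _ : MeasurableSpace (proportionSet K) := MeasurableSpace.generateFrom (boxAlgebra K)
      have hcoord : ∀ k, Measurable fun p : proportionSet K => p.1 k := by
        intro k
        rw [BorelSpace.measurable_eq (α := ℝ), Real.borel_eq_generateFrom_Ioi_rat]
        refine measurable_generateFrom fun S hS => ?_
        simp only [Set.mem_iUnion, Set.mem_singleton_iff] at hS
        obtain ⟨r, rfl⟩ := hS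
        refine MeasurableSpace.measurableSet_generateFrom ?_
        convert boxTrace_mem_boxAlgebra (Function.update (fun _ : Fin K => (-1 : ℚ)) k r)
          (fun _ => 2) using 1
        ext p
        have h01 := p.2.1
        constructor
        · intro hp l
          refine ⟨?_, by push_cast; linarith [(h01 l).2]⟩
          rcases eq_or_ne l k with rfl | hl
          · simpa using hp
          · rw [Function.update_of_ne hl]; push_cast; linarith [(h01 l).1]
        · intro hp
          simpa using (hp k).1
      have hval : Measurable fun p : proportionSet K => WithLp.toLp 2 fun k => p.1 k :=
        (WithLp.measurable_toLp 2 _).comp (measurable_pi_iff.2 hcoord)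
      exact Measurable.subtype_mk (h := fun p => p.2) hval
    intro S hS
    exact hid hS
  · refine MeasurableSpace.generateFrom_le fun S hS => ?_
    have := measurable_of_mem_boxGroup hS (measurableSet_singleton 1)
    convert this using 1
    ext p
    by_cases hp : p ∈ S <;> simp [hp]

/-- In a finite measure space a generating algebra is dense; a null measurable set is first replaced
by its measurable hull, which is almost everywhere equal to it. -/
theorem exists_mem_boxAlgebra_symmDiff_le {S : Set (proportionSet K)}
    (hS : NullMeasurableSet S (proportionVolume K)) {ε : ℝ} (hε : 0 < ε) :
    ∃ T ∈ boxAlgebra K, proportionVolume K (symmDiff S T) ≤ ENNReal.ofReal ε := by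
  obtain ⟨T, hT, hlt⟩ := (Measure.MeasureDense.of_generateFrom_isSetAlgebra_finite
    (proportionVolume K) (isSetAlgebra_boxAlgebra K) (generateFrom_boxAlgebra K)).approx
    (toMeasurable (proportionVolume K) S) (measurableSet_toMeasurable _ _)
    (measure_ne_top _ _) ε hε
  refine ⟨T, hT, ?_⟩
  rw [measure_congr (hS.toMeasurable_ae_eq.symm.symmDiff (ae_eq_refl T))]
  exact hlt.le

end BoxAlgebra

/-! ### Approximation by box functions -/

/-- A finite-valued function with measurable level sets is approximated by box functions. -/
theorem exists_isBoxFunction_volume_ne_le {R : Type*} [AddCommGroup R] {Y : Set R} (hY : Y.Finite)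
    (y₀ : Y) {K : ℕ} (h : proportionSet K → Y)
    (hmeas : ∀ y : Y, NullMeasurableSet (levelSet h y) (proportionVolume K))
    {ε : ℝ} (hε : 0 < ε) :
    ∃ g : proportionSet K → Y, IsBoxFunction g ∧
      proportionVolume K {p | h p ≠ g p} ≤ ENNReal.ofReal ε := by
  classical
  have := hY.fintype
  have hcard : (0 : ℝ) < Fintype.card Y := by
    exact_mod_cast Fintype.card_pos_iff.2 ⟨y₀⟩
  choose S hS hSle using fun y => exists_mem_boxAlgebra_symmDiff_le (hmeas y) (div_pos hε hcard)
  -- Removing all overlaps makes the approximate level sets disjoint, so that `g` can be defined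
  -- with values in `Y`.
  let T : Y → Set (proportionSet K) := fun y => S y \ ⋃ z ∈ Finset.univ.erase y, S z
  have hT : ∀ y, T y ∈ boxAlgebra K := fun y =>
    (isSetAlgebra_boxAlgebra K).sdiff_mem (hS y)
      ((isSetAlgebra_boxAlgebra K).biUnion_mem _ fun z _ => hS z)
  have memT : ∀ y p, p ∈ T y ↔ p ∈ S y ∧ ∀ z ≠ y, p ∉ S z := fun y p => by simp [T]
  have uniq : ∀ y z p, p ∈ T y → p ∈ T z → y = z := fun y z p hy hz => by
    by_contra hne
    exact ((memT z p).1 hz).2 y hne ((memT y p).1 hy).1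
  let g : proportionSet K → Y := fun p => if hp : ∃ y, p ∈ T y then hp.choose else y₀
  have hg : ∀ y p, p ∈ T y → g p = y := fun y p hp => by
    have hex : ∃ y, p ∈ T y := ⟨y, hp⟩
    simp only [g, dif_pos hex]
    exact uniq _ _ p hex.choose_spec hp
  refine ⟨g, ?_, ?_⟩
  · have hsum : IsBoxSum fun p => Set.univ.indicator (fun _ => (y₀ : R)) p +
        ∑ y, (T y).indicator (fun _ => (y : R) - y₀) p :=
      (isBoxSum_indicator (isSetAlgebra_boxAlgebra K).univ_mem _).add
        (IsBoxSum.sum _ fun y _ => isBoxSum_indicator (hT y) _)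
    -- The default `y₀` off the sets `T y` is the constant term, corrected by `y - y₀` on each `T
    -- y`.
    have hrep : (fun p => (g p : R)) = fun p => Set.univ.indicator (fun _ => (y₀ : R)) p +
        ∑ y, (T y).indicator (fun _ => (y : R) - y₀) p := by
      funext p
      rw [Set.indicator_univ]
      by_cases hp : ∃ y, p ∈ T y
      · obtain ⟨y, hy⟩ := hp
        rw [hg y p hy, Finset.sum_eq_single y, Set.indicator_of_mem hy, add_sub_cancel]
        · intro z _ hz
          exact Set.indicator_of_notMem (fun hz' => hz (uniq _ _ p hz' hy)) _
        · simp
      · rw [Finset.sum_eq_zero, add_zero]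
        · simp only [g, dif_neg hp]
        · intro y _
          exact Set.indicator_of_notMem (fun hy => hp ⟨y, hy⟩) _
    rw [← hrep] at hsum
    exact hsum
  -- Off all the symmetric differences, `p` lies in `S (h p)` and in no other `S z`, so `p ∈ T (h
  -- p)`.
  · have hsub : {p | h p ≠ g p} ⊆ ⋃ y, symmDiff (levelSet h y) (S y) := by
      intro p hp
      by_contra hcon
      simp only [Set.mem_iUnion, not_exists, Set.mem_symmDiff, levelSet, Set.mem_ofPred_eq,
        not_or, not_and, not_not] at hcon
      refine hp (hg _ p ((memT _ p).2 ⟨(hcon (h p)).1 rfl, fun z hz hpz => hz ?_⟩)).symm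
      exact ((hcon z).2 hpz).symm
    calc proportionVolume K {p | h p ≠ g p}
        ≤ ∑ y, proportionVolume K (symmDiff (levelSet h y) (S y)) :=
          (measure_mono hsub).trans (measure_iUnion_fintype_le _ _)
      _ ≤ ∑ _y : Y, ENNReal.ofReal (ε / Fintype.card Y) := Finset.sum_le_sum fun y _ => hSle y
      _ = ENNReal.ofReal ε := by
          rw [Finset.sum_const, Finset.card_univ, ← ENNReal.ofReal_nsmul, nsmul_eq_mul,
            mul_div_cancel₀ _ hcard.ne']

end AnonNet

end

theorem corollary1 {R : Type*} [AddCommGroup R] (Y : Set R) (hY : Y.Finite) (y₀ : Y) (K : ℕ)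
    (h : AnonNet.proportionSet K → Y)
    (hmeas : ∀ y : Y,
      MeasureTheory.NullMeasurableSet (AnonNet.levelSet h y) (AnonNet.proportionVolume K))
    (ε : ℝ) (hε : 0 < ε) :
    ∃ g : AnonNet.proportionSet K → Y,
      AnonNet.IsBoxFunction g ∧ AnonNet.IsComputable y₀ g ∧
        AnonNet.proportionVolume K {p | h p ≠ g p} ≤ ENNReal.ofReal ε := by
  obtain ⟨g, hg, hle⟩ := AnonNet.exists_isBoxFunction_volume_ne_le hY y₀ h hmeas hε
  exact ⟨g, hg, hg.isComputable y₀, hle⟩
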